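/- A Euclidean Jordan algebra (EJA) is a finite-dimensional real vector space $\mathcal J$ with a commutative bilinear product $\circ$ that has an identity $e$, satisfies $x^2\circ(x\circ y)=x\circ(x^2\circ y)$, and admits an inner product $(\cdot,\cdot)$ with $(x\circ y,z)=(y,x\circ z)$. Every $x\in\mathcal J$ has a spectral decomposition $x=\sum_{k=1}^r\lambda_k q_k$ over a Jordan frame (primitive idempotents with $q_k\circ q_l=0$ for $k\ne l$ and $\sum_k q_k=e$); its eigenvalues $\lambda_k$ are unique up to order. Put $\operatorname{tr}(x)=\sum_k\lambda_k$, $\langle x,y\rangle=\operatorname{tr}(x\circ y)$, $\|x\|_{\mathrm{tr},1}=\sum_k|\lambda_k|$, $\|x\|_{\mathrm{tr},\infty}=\max_k|\lambda_k|$, and let $\|v\|_{\mathrm{tr},1,*}=\sup\{\langle w,v\rangle:\|w\|_{\mathrm{tr},1}\le1\}$ be the dual norm. With $\mathcal K=\{x\circ x:x\in\mathcal J\}$ the cone of squares, the generalized simplex is $\Delta_{\mathcal K}=\{x\in\mathcal K:\operatorname{tr}(x)=1\}$. **Proposition.** Let $\mathcal N$ be a finite set of players, let $\mathcal J_i$ ($i\in\mathcal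 N$) be EJAs with cones of squares $\mathcal K_i$, and let $\mathcal X=\prod_{i}\Delta_{\mathcal K_i}$. For each $i$ let $u_i:\prod_j\mathcal J_j\to\mathbb R$ be multilinear with $|u_i(x)|\le L_i$ for all $x\in\mathcal X$. Then the payoff vectors $m_i(x)=\nabla_{x_i}u_i(x)\in\mathcal J_i$ (the gradient in the variable $x_i$ with respect to the inner product $\langle\cdot,\cdot\rangle$ of $\mathcal J_i$) exist for all $x\in\mathcal X$, and the following hold. 1. For every sequence $(x^t)_{t\ge0}$ in $\mathcal X$, with $m_i^t=m_i(x^t)$, for every player $i$ and every $t\ge1$, $$\|m_i^t-m_i^{t-1}\|_{\mathrm{tr},1,*}\le L_i\sum_{j\ne i}\|x_j^t-x_j^{t-1}\|_{\mathrm{tr},1}\quad\text{and}\quad \|m_i^t-m_i^{t-1}\|_{\mathrm{tr},\infty}\le L_i\sum_{j\ne i}\|x_j^t-x_j^{t-1}\|_{\mathrm{tr},1}.$$ 2. For every player $i$ and all $x,y\in\mathcal X$, $\|m_i(x)-m_i(y)\|_{\mathrm{tr},\infty}\le L_i\|x-y\|_{\mathrm{tr},1}$, where the last norm is that of the product EJA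 $\prod_j\mathcal J_j$. In particular there are constants $L_i'\ge0$, independent of $x$ and $y$, with $\|m_i(x)-m_i(y)\|_{\mathrm{tr},\infty}\le L_i'\|x-y\|_{\mathrm{tr},1}$ for all $i$ and all $x,y\in\mathcal X$. -/

import Mathlib

/-- A (finite-dimensional, unital, real) Euclidean Jordan algebra: `J` is a commutative, possibly
non-associative ring with identity `1`, its multiplication is the bilinear Jordan product `∘`,
the Jordan identity holds (`IsCommJordan`), and there is an associative inner product on `J`. -/
class IsEuclideanJordanAlgebra (J : Type*) [NonAssocCommRing J] [Module ℝ J] : Prop where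
  smul_mul : ∀ (c : ℝ) (x y : J), (c • x) * y = c • (x * y)
  jordan : IsCommJordan J
  finiteDimensional : FiniteDimensional ℝ J
  exists_inner : ∃ B : LinearMap.BilinForm ℝ J,
    (∀ x y, B x y = B y x) ∧ (∀ x, x ≠ 0 → 0 < B x x) ∧ ∀ x y z, B (x * y) z = B y (x * z)

namespace EJA

section Algebra

variable {J : Type*} [NonAssocCommRing J] [Module ℝ J]

/-- A nonzero idempotent that is not a sum of two nonzero idempotents. -/
def IsPrimitiveIdempotent (p : J) : Prop :=
  IsIdempotentElem p ∧ p ≠ 0 ∧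
    ¬ ∃ a b : J, IsIdempotentElem a ∧ IsIdempotentElem b ∧ a ≠ 0 ∧ b ≠ 0 ∧ p = a + b

/-- A Jordan frame `q₁, …, q_r`. -/
structure IsJordanFrame {r : ℕ} (q : Fin r → J) : Prop where
  primitive : ∀ k, IsPrimitiveIdempotent (q k)
  orthogonal : ∀ k l, k ≠ l → q k * q l = 0
  sum_eq_one : ∑ k, q k = 1

/-- `x = ∑ₖ lₖ qₖ` is a spectral decomposition of `x` over the Jordan frame `q`. -/
def IsSpectralDecomposition (x : J) {r : ℕ} (q : Fin r → J) (l : Fin r → ℝ) : Prop :=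
  IsJordanFrame q ∧ x = ∑ k, l k • q k

/-- `s` is the multiset of coefficients of some spectral decomposition of `x`. -/
def IsEigenvalueMultiset (x : J) (s : Multiset ℝ) : Prop :=
  ∃ (r : ℕ) (q : Fin r → J) (l : Fin r → ℝ),
    IsSpectralDecomposition x q l ∧ s = Finset.univ.val.map l

open Classical in
/-- The eigenvalues of `x`, with multiplicity. In a Euclidean Jordan algebra a spectral
decomposition exists and determines this multiset uniquely. -/
noncomputable def eigenvalues (x : J) : Multiset ℝ :=
  if h : ∃ s, IsEigenvalueMultiset x s then h.choose else 0

/-- The trace: the sum of the eigenvalues. -/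
noncomputable def trace (x : J) : ℝ := (eigenvalues x).sum

/-- The canonical inner product `⟨x, y⟩ = tr (x ∘ y)`. -/
noncomputable def traceInner (x y : J) : ℝ := trace (x * y)

/-- The trace-1 norm: the sum of the absolute values of the eigenvalues. -/
noncomputable def trNormOne (x : J) : ℝ := ((eigenvalues x).map fun l => |l|).sum

/-- The trace-∞ norm: the largest absolute value of an eigenvalue. -/
noncomputable def trNormInf (x : J) : ℝ := sSup {a : ℝ | ∃ l ∈ eigenvalues x, a = |l|}

/-- The dual norm of the trace-1 norm, for the pairing `⟨·, ·⟩`. -/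
noncomputable def trNormOneDual (v : J) : ℝ :=
  sSup {a : ℝ | ∃ w : J, trNormOne w ≤ 1 ∧ a = traceInner w v}

/-- `g` is the (Fréchet) gradient of `f` at `x`, with respect to the canonical inner product:
`f (x + h) = f x + ⟨g, h⟩ + o(‖h‖)` as `h → 0`. -/
def IsGradientAt (f : J → ℝ) (g x : J) : Prop :=
  ∀ ε > 0, ∃ δ > 0, ∀ h : J, trNormOne h < δ →
    |f (x + h) - f x - traceInner g h| ≤ ε * trNormOne h

open Classical in
/-- The gradient of `f` at `x` (`0` if there is none). -/
noncomputable def gradientAt (f : J → ℝ) (x : J) : J :=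
  if h : ∃ g, IsGradientAt f g x then h.choose else 0

variable (J) in
/-- The symmetric cone of `J`, that is, its cone of squares. -/
def coneOfSquares : Set J := {x | ∃ y : J, x = y * y}

variable (J) in
/-- The generalized simplex: the trace-one slice of the cone of squares. -/
def genSimplex : Set J := {x | x ∈ coneOfSquares J ∧ trace x = 1}

end Algebra

/-- The product of Jordan algebras, with componentwise operations. -/
instance piNonAssocCommRing {ι : Type*} {J : ι → Type*} [∀ i, NonAssocCommRing (J i)] :
    NonAssocCommRing (∀ i, J i) :=
  { (inferInstance : NonAssocRing (∀ i, J i)) with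
    mul_comm := fun x y => funext fun i => mul_comm (x i) (y i) }

section Game

variable {ι : Type*} {J : ι → Type*} [∀ i, NonAssocCommRing (J i)] [∀ i, Module ℝ (J i)]

variable (J) in
/-- The joint strategies of a symmetric cone game: the product of the generalized simplices. -/
def jointStrategies : Set (∀ i, J i) := {x | ∀ i, x i ∈ genSimplex (J i)}

/-- The payoff vector `m_i(x) = ∇_{x_i} u_i(x_i, x_{-i})` of player `i` with utility `ui`. -/
noncomputable def payoffVector [DecidableEq ι] (ui : (∀ j, J j) → ℝ) (i : ι) (x : ∀ j, J j) :
    J i :=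
  gradientAt (fun y : J i => ui (Function.update x i y)) (x i)

/-- Each payoff vector `m_i` is `L_i`-Lipschitz on the joint strategies. The norm of `x - y` is
the trace-1 norm of the product Jordan algebra `∏ j, J j`. -/
def PayoffsLipschitzWith [DecidableEq ι] (u : ι → (∀ j, J j) → ℝ) (L : ι → ℝ) : Prop :=
  ∀ i, ∀ x ∈ jointStrategies J, ∀ y ∈ jointStrategies J,
    trNormInf (payoffVector (u i) i x - payoffVector (u i) i y) ≤ L i * trNormOne (x - y)

/-- The smoothness assumption on a game: the payoff vectors are Lipschitz. -/
def HasLipschitzPayoffs [DecidableEq ι] (u : ι → (∀ j, J j) → ℝ) : Prop :=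
  ∃ L : ι → ℝ, (∀ i, 0 ≤ L i) ∧ PayoffsLipschitzWith u L

end Game

end EJA

namespace EJA

/-! Since `u i` is linear in each slot, the payoff vector represents `w ↦ u i (Function.update x i
w)` under the trace pairing. Everything reduces to the estimate `|u z| ≤ L * ∏ i, trNormOne (z i)`
of `abs_multilinear_le`: decompose each `z i` spectrally and expand; each remaining value of `u` is
taken at a tuple of primitive idempotents, which is a point of the joint strategies. Replacing the
strategies of the players other than `i` one at a time (`abs_multilinear_piecewise_sub_le`) then
bounds the pairing of a difference of payoff vectors with any `w`. Taking the supremum over `w`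
gives the dual norm; testing on the frame of the difference gives its eigenvalues.

The rest is Jordan theory. Eigenvalues are selected by choice, so what is needed is that the trace
is linear and that the trace-1 norm is at most the sum of absolute coefficients in any combination
of primitive idempotents (`trNormOne_le_sum`). Both rest on `IsAssocInner.frame_sum_eq_one`: the
weights `B (q k) p / B (q k) (q k)` of a primitive `p` against a Jordan frame sum to one. They are
also nonnegative, by the Peirce equation. Uniqueness of the eigenvalue multiset is never used. -/

/-- A symmetric positive definite bilinear form for which the multiplication operators are
self-adjoint. -/
structure IsAssocInner {J : Type*} [NonAssocCommRing J] [Module ℝ J]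
    (B : LinearMap.BilinForm ℝ J) : Prop where
  symm : ∀ x y, B x y = B y x
  pos : ∀ x, x ≠ 0 → 0 < B x x
  assoc : ∀ x y z, B (x * y) z = B y (x * z)

/-! ### Multiplication operators and power associativity -/

section Operators

variable {J : Type*} [NonAssocCommRing J] [Module ℝ J] [IsEuclideanJordanAlgebra J]

instance isScalarTower_of_eja : IsScalarTower ℝ J J :=
  ⟨fun c x y => IsEuclideanJordanAlgebra.smul_mul c x y⟩

instance smulCommClass_of_eja : SMulCommClass ℝ J J :=
  ⟨fun c x y => by
    simp only [smul_eq_mul]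
    rw [mul_comm x (c • y), IsEuclideanJordanAlgebra.smul_mul, mul_comm y x]⟩

instance isCommJordan_of_eja : IsCommJordan J :=
  IsEuclideanJordanAlgebra.jordan

instance finiteDimensional_of_eja : FiniteDimensional ℝ J :=
  IsEuclideanJordanAlgebra.finiteDimensional

variable (J) in
theorem exists_isAssocInner : ∃ B : LinearMap.BilinForm ℝ J, IsAssocInner B :=
  let ⟨B, h₁, h₂, h₃⟩ := IsEuclideanJordanAlgebra.exists_inner (J := J)
  ⟨B, h₁, h₂, h₃⟩

/-- The linearized Jordan identity. -/
theorem mul_self_mul_mul (x y z : J) :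
    (x * x * y) * z = (x * x) * (y * z) + (2 : ℝ) • ((x * y) * (x * z))
      - (2 : ℝ) • (x * (y * (x * z))) := by
  have h : (2 : ℕ) • ((x * (x * z * y) - x * z * (x * y)) + (x * (z * x * y) - z * x * (x * y))
      + (z * (x * x * y) - x * x * (z * y))) = 0 :=
    DFunLike.congr_fun (two_nsmul_lie_lmul_lmul_add_add_eq_zero x x z) y
  rw [mul_comm z x, mul_comm (x * z) y, mul_comm (x * z) (x * y), mul_comm z (x * x * y),
    mul_comm z y] at h
  have h2 : (2 : ℝ) • ((x * (y * (x * z)) - (x * y) * (x * z)) + (x * (y * (x * z)) - (x * y) * (x * z))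
      + (x * x * y * z - x * x * (y * z))) = 0 := by
    rw [ofNat_smul_eq_nsmul]; exact h
  have h3 := (smul_eq_zero.1 h2).resolve_left two_ne_zero
  rw [← sub_eq_zero, ← h3]
  module

/-- Multiplication by `x` as a linear operator. -/
noncomputable abbrev lmul (x : J) : Module.End ℝ J := LinearMap.mulLeft ℝ x

theorem lmul_mul_self_mul (x y : J) :
    lmul (x * x * y) = lmul (x * x) * lmul y + (2 : ℝ) • (lmul (x * y) * lmul x)
      - (2 : ℝ) • (lmul x * lmul y * lmul x) := by
  ext z
  simpa using mul_self_mul_mul x y z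

theorem commute_lmul_mul_self (x : J) : Commute (lmul x) (lmul (x * x)) := by
  ext z
  have := IsCommJordan.lmul_comm_rmul_rmul x z
  simp only [Module.End.mul_apply, LinearMap.mulLeft_apply]
  rw [mul_comm (x * x) z, ← this, mul_comm]

/-- The linearized Jordan identity writes the operator of the power `n + 2` through those of the
powers `n` and `n + 1`, of `x * x` and of `x`. The induction therefore carries two consecutive
powers, and commutation with `lmul (x * x)` as well. -/
theorem commute_lmul_pow_apply_one (x : J) (n : ℕ) :
    (Commute (lmul ((lmul x ^ n) 1)) (lmul x) ∧ Commute (lmul ((lmul x ^ n) 1)) (lmul (x * x))) ∧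
    (Commute (lmul ((lmul x ^ (n + 1)) 1)) (lmul x) ∧
      Commute (lmul ((lmul x ^ (n + 1)) 1)) (lmul (x * x))) := by
  have hx := commute_lmul_mul_self x
  induction n with
  | zero =>
    have h1 : lmul (1 : J) = 1 := by ext; simp
    simp [h1, hx, -LinearMap.mulLeft_mul]
  | succ n ih =>
    obtain ⟨⟨h1, h2⟩, h3, h4⟩ := ih
    refine ⟨⟨h3, h4⟩, ?_⟩
    have key : (lmul x ^ (n + 1 + 1)) 1 = x * x * ((lmul x ^ n) 1) := by
      have hc : (lmul x ^ n * lmul (x * x)) 1 = (lmul (x * x) * lmul x ^ n) 1 := by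
        rw [(hx.pow_left n).eq]
      simp only [Module.End.mul_apply, LinearMap.mulLeft_apply, mul_one] at hc
      rw [← hc, pow_succ, pow_succ]
      simp
    have h5 : x * ((lmul x ^ n) 1) = (lmul x ^ (n + 1)) 1 := by
      rw [pow_succ']; simp
    rw [key, lmul_mul_self_mul, h5]
    constructor
    · exact ((hx.symm.mul_left h1).add_left ((h3.mul_left (.refl _)).smul_left _)).sub_left
        ((((Commute.refl _).mul_left h1).mul_left (.refl _)).smul_left _)
    · exact (((Commute.refl _).mul_left h2).add_left ((h4.mul_left hx).smul_left _)).sub_left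
        (((hx.mul_left h2).mul_left hx).smul_left _)

/-- Multiplication by a polynomial in `x` commutes with multiplication by `x`. -/
theorem commute_lmul_aeval_apply_one (x : J) (f : Polynomial ℝ) :
    Commute (lmul ((Polynomial.aeval (lmul x) f) 1)) (lmul x) := by
  induction f using Polynomial.induction_on' with
  | add p q hp hq =>
    have : lmul ((Polynomial.aeval (lmul x) (p + q)) 1) =
        lmul ((Polynomial.aeval (lmul x) p) 1) + lmul ((Polynomial.aeval (lmul x) q) 1) := by
      ext z; simp [add_mul]
    rw [this]
    exact hp.add_left hq
  | monomial n a =>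
    have : lmul ((Polynomial.aeval (lmul x) (Polynomial.monomial n a)) 1) =
        a • lmul ((lmul x ^ n) 1) := by
      ext z; simp [Polynomial.aeval_monomial, Module.algebraMap_end_apply, smul_mul_assoc]
    rw [this]
    exact (commute_lmul_pow_apply_one x n).1.1.smul_left a

omit [IsEuclideanJordanAlgebra J] in
theorem IsAssocInner.assoc_right {B : LinearMap.BilinForm ℝ J} (hB : IsAssocInner B) (x y z : J) :
    B (x * y) z = B x (y * z) := by
  rw [mul_comm, hB.assoc]

end Operators

/-! ### Diagonalization and spectral idempotents -/

/-- A linear operator that is symmetric for a positive definite form is diagonalizable. -/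
theorem iSup_eigenspace_eq_top_of_symmetric {V : Type*} [AddCommGroup V] [Module ℝ V]
    [FiniteDimensional ℝ V] (B : LinearMap.BilinForm ℝ V) (hs : ∀ x y, B x y = B y x)
    (hp : ∀ x, x ≠ 0 → 0 < B x x) (T : Module.End ℝ V) (hT : ∀ x y, B (T x) y = B x (T y)) :
    ⨆ μ, Module.End.eigenspace T μ = ⊤ := by
  let c : InnerProductSpace.Core ℝ V :=
    { inner := fun x y => B x y
      conj_inner_symm := fun x y => by simpa using hs y x
      re_inner_nonneg := fun x => by
        by_cases h : x = 0
        · simp [h]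
        · simpa using (hp x h).le
      add_left := fun x y z => by simp
      smul_left := fun x y r => by simp
      definite := fun x h => by
        by_contra hx
        exact (hp x hx).ne' h }
  let _ : NormedAddCommGroup V := c.toNormedAddCommGroup
  let _ : InnerProductSpace ℝ V := InnerProductSpace.ofCore c.toCore
  have h : LinearMap.IsSymmetric (𝕜 := ℝ) T := fun x y => hT x y
  have := h.orthogonalComplement_iSup_eigenspaces_eq_bot
  rwa [Submodule.orthogonal_eq_bot_iff] at this

section Spectral

variable {J : Type*} [NonAssocCommRing J] [Module ℝ J] [IsEuclideanJordanAlgebra J]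

/-- The identity is a sum of orthogonal idempotents that are eigenvectors of `x` and polynomials
in `x`. -/
theorem exists_spectral_idempotents (x : J) :
    ∃ (s : Finset ℝ) (v : ℝ → J), (∑ a ∈ s, v a = 1) ∧ (∀ a ∈ s, x * v a = a • v a) ∧
      (∀ a ∈ s, ∀ b ∈ s, a ≠ b → v a * v b = 0) ∧ (∀ a ∈ s, v a * v a = v a) ∧
      ∀ a ∈ s, ∃ f : Polynomial ℝ, v a = Polynomial.aeval (lmul x) f 1 := by
  obtain ⟨B, hB⟩ := exists_isAssocInner J
  have htop := iSup_eigenspace_eq_top_of_symmetric B hB.symm hB.pos (lmul x)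
    (fun y z => by simpa using hB.assoc x y z)
  have h1 : (1 : J) ∈ ⨆ μ, Module.End.eigenspace (lmul x) μ := htop ▸ Submodule.mem_top
  obtain ⟨w, hw, hsum⟩ := (Submodule.mem_iSup_iff_exists_finsupp _ _).1 h1
  have heig : ∀ a, x * w a = a • w a := fun a => by
    simpa using Module.End.mem_eigenspace_iff.1 (hw a)
  have haeval : ∀ a (f : Polynomial ℝ), Polynomial.aeval (lmul x) f (w a) = f.eval a • w a := by
    intro a f
    by_cases h0 : w a = 0
    · simp [h0]
    · exact Module.End.aeval_apply_of_hasEigenvector ⟨hw a, h0⟩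
  -- The Lagrange polynomial that is 1 at `a` and 0 at the other eigenvalues isolates the
  -- `a`-component of `1`.
  have hpoly : ∀ a ∈ w.support, w a = Polynomial.aeval (lmul x) (Lagrange.basis w.support id a) 1 := by
    intro a ha
    rw [← hsum, Finsupp.sum, map_sum, Finset.sum_eq_single a]
    · rw [haeval]
      have := Lagrange.eval_basis_self (v := id) (s := w.support) (Set.injOn_id _) ha
      simp only [id] at this
      rw [this, one_smul]
    · intro b hb hba
      rw [haeval]
      have := Lagrange.eval_basis_of_ne (v := id) (s := w.support) hba.symm hb
      simp only [id] at this
      rw [this, zero_smul]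
    · intro h; exact absurd ha h
  -- Both `lmul (w a)` and `lmul (w b)` commute with `lmul x`, so `w a * w b` is multiplied by `x`
  -- both as by `b` and as by `a`.
  have horth : ∀ a ∈ w.support, ∀ b ∈ w.support, a ≠ b → w a * w b = 0 := by
    intro a ha b hb hab
    have hc := commute_lmul_aeval_apply_one x (Lagrange.basis w.support id a)
    rw [← hpoly a ha] at hc
    have h2 := congrArg (fun f : Module.End ℝ J => f (w b)) hc.eq
    have hc' := commute_lmul_aeval_apply_one x (Lagrange.basis w.support id b)
    rw [← hpoly b hb] at hc'
    have h3 := congrArg (fun f : Module.End ℝ J => f (w a)) hc'.eq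
    simp only [Module.End.mul_apply, LinearMap.mulLeft_apply, heig, mul_smul_comm] at h2 h3
    rw [mul_comm (w b) (w a), ← h2] at h3
    have h4 : (a - b) • (w a * w b) = 0 := by rw [sub_smul, h3, sub_self]
    exact (smul_eq_zero.1 h4).resolve_left (sub_ne_zero.2 hab)
  refine ⟨w.support, w, hsum, fun a _ => heig a, horth, ?_, fun a ha => ⟨_, hpoly a ha⟩⟩
  intro a ha
  have h5 : w a * ∑ b ∈ w.support, w b = w a * w a := by
    rw [Finset.mul_sum, Finset.sum_eq_single a (fun b hb hba => horth a ha b hb hba.symm)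
      (fun h => absurd ha h)]
  have h6 : ∑ b ∈ w.support, w b = 1 := hsum
  rw [← h5, h6, mul_one]

end Spectral

/-! ### Peirce theory, Jordan frames and primitive idempotents -/

section Peirce

variable {J : Type*} [NonAssocCommRing J] [Module ℝ J] [IsEuclideanJordanAlgebra J]
  {B : LinearMap.BilinForm ℝ J}

/-- The Peirce equation `2 L³ - 3 L² + L = 0` for multiplication by an idempotent. -/
theorem peirce_equation {p : J} (hp : p * p = p) (z : J) :
    (2 : ℝ) • (p * (p * (p * z))) = (3 : ℝ) • (p * (p * z)) - p * z := by
  have h := mul_self_mul_mul p p z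
  simp only [hp] at h
  calc (2 : ℝ) • (p * (p * (p * z))) = (3 : ℝ) • (p * (p * z)) - (p * (p * z)
        + (2 : ℝ) • (p * (p * z)) - (2 : ℝ) • (p * (p * (p * z)))) := by module
    _ = _ := by rw [← h]

/-- By the Peirce equation `lmul p` has eigenvalues in {0, 1/2, 1}, where t = (2t² - t)² + 8(t -
t²)². With `b = p * a` and `c = p * b` this exhibits `B b a` as a sum of two squared norms, and both
vanish only if `b = 0`. -/
theorem IsAssocInner.idempotent_mul_self_nonneg (hB : IsAssocInner B) {p : J} (hp : p * p = p)
    (a : J) : 0 ≤ B (p * a) a ∧ (B (p * a) a = 0 → p * a = 0) := by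
  have hnn : ∀ x, 0 ≤ B x x := fun x => by
    by_cases h : x = 0
    · simp [h]
    · exact (hB.pos x h).le
  have hz : ∀ x, B x x = 0 → x = 0 := fun x h => by
    by_contra hx
    exact (hB.pos x hx).ne' h
  obtain ⟨b, hb⟩ : ∃ b, b = p * a := ⟨_, rfl⟩
  obtain ⟨c, hc⟩ : ∃ c, c = p * b := ⟨_, rfl⟩
  have hd : (2 : ℝ) • (p * c) = (3 : ℝ) • c - b := by
    rw [hc, hb]; exact peirce_equation hp a
  have e1 : B b b = B a c := by
    conv_lhs => rw [hb]
    rw [hB.assoc, ← hb, ← hc]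
  have e2 : 2 * B b c = 3 * B a c - B a b := by
    have : B b c = B a (p * c) := by rw [hb, hB.assoc]
    rw [this, ← smul_eq_mul, ← map_smul, hd]; simp
  have e3 : 2 * B c c = 3 * B b c - B b b := by
    have : B c c = B b (p * c) := by conv_lhs => rw [hc, hB.assoc, ← hc]
    rw [this, ← smul_eq_mul, ← map_smul, hd]; simp
  have e4 : B c b = B b c := hB.symm _ _
  have e5 : B b a = B a b := hB.symm _ _
  have f1 : B ((2 : ℝ) • c - b) ((2 : ℝ) • c - b) = 4 * B c c - 4 * B b c + B b b := by
    simp [e4]; ring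
  have f2 : B (b - c) (b - c) = B b b - 2 * B b c + B c c := by
    simp [e4]; ring
  have key : B b a = B ((2 : ℝ) • c - b) ((2 : ℝ) • c - b) + 8 * B (b - c) (b - c) := by
    rw [f1, f2]; linarith
  have g1 := hnn ((2 : ℝ) • c - b)
  have g2 := hnn (b - c)
  rw [← hb]
  refine ⟨by linarith, fun h => ?_⟩
  have k1 := hz _ (show B ((2 : ℝ) • c - b) ((2 : ℝ) • c - b) = 0 by linarith)
  have k2 := hz _ (show B (b - c) (b - c) = 0 by linarith)
  have : b = ((2 : ℝ) • c - b) + (2 : ℝ) • (b - c) := by module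
  rw [this, k1, k2]; simp

theorem IsAssocInner.idempotent_nonneg (hB : IsAssocInner B) {p a : J} (hp : p * p = p)
    (ha : a * a = a) : 0 ≤ B p a ∧ (B p a = 0 → p * a = 0) := by
  have h := hB.idempotent_mul_self_nonneg hp a
  rwa [hB.assoc_right, ha] at h

omit [IsEuclideanJordanAlgebra J] in
theorem IsAssocInner.eq_zero_of_mul_eq_zero (hB : IsAssocInner B) {p q : J} (h : p * q = 0) :
    B p q = 0 := by
  rw [← mul_one p, hB.assoc, h]; simp

theorem mul_eq_zero_of_add {J : Type*} [NonAssocCommRing J] [Module ℝ J] {a b : J} (ha : a * a = a) (hb : b * b = b)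
    (hab : (a + b) * (a + b) = a + b) : a * b = 0 := by
  rw [add_mul, mul_add, mul_add, ha, hb, mul_comm b a] at hab
  have : (2 : ℝ) • (a * b) = (a + a * b + (a * b + b)) - (a + b) := by module
  rw [hab, sub_self] at this
  exact (smul_eq_zero.1 this).resolve_left two_ne_zero

/-- `S` is a complete system of orthogonal idempotents whose span contains `x`. -/
structure IsIdempotentSystem (x : J) (S : Finset J) : Prop where
  idem : ∀ q ∈ S, q * q = q
  ne_zero : ∀ q ∈ S, q ≠ 0
  orth : ∀ q ∈ S, ∀ q' ∈ S, q ≠ q' → q * q' = 0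
  sum_eq_one : ∑ q ∈ S, q = 1
  mem_span : x ∈ Submodule.span ℝ (S : Set J)

theorem exists_isIdempotentSystem (x : J) : ∃ S, IsIdempotentSystem x S := by
  classical
  obtain ⟨s, v, hsum, heig, horth, hidem, -⟩ := exists_spectral_idempotents x
  -- Dropping zero idempotents makes `v` injective: equal orthogonal idempotents are zero.
  let s' := s.filter fun a => v a ≠ 0
  have hs' : ∀ a ∈ s', a ∈ s ∧ v a ≠ 0 := fun a ha => Finset.mem_filter.1 ha
  have hinj : Set.InjOn v s' := by
    intro a ha b hb hab
    by_contra hne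
    have h := horth a (hs' a ha).1 b (hs' b hb).1 hne
    rw [← hab, hidem a (hs' a ha).1] at h
    exact (hs' a ha).2 h
  refine ⟨s'.image v, ?_, ?_, ?_, ?_, ?_⟩
  · simp only [Finset.forall_mem_image]
    exact fun a ha => hidem a (hs' a ha).1
  · simp only [Finset.forall_mem_image]
    exact fun a ha => (hs' a ha).2
  · simp only [Finset.forall_mem_image]
    exact fun a ha b hb hab => horth a (hs' a ha).1 b (hs' b hb).1 fun h => hab (h ▸ rfl)
  · rw [Finset.sum_image hinj, Finset.sum_filter_ne_zero, hsum]
  · have hx : x = ∑ a ∈ s, a • v a := by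
      rw [← Finset.sum_congr rfl heig, ← Finset.mul_sum, hsum, mul_one]
    rw [hx]
    refine Submodule.sum_mem _ fun a ha => Submodule.smul_mem _ _ ?_
    by_cases h0 : v a = 0
    · rw [h0]; exact Submodule.zero_mem _
    · exact Submodule.subset_span (Finset.mem_coe.2
        (Finset.mem_image_of_mem v (Finset.mem_filter.2 ⟨ha, h0⟩)))

theorem IsIdempotentSystem.card_le {x : J} {S : Finset J} (h : IsIdempotentSystem x S) :
    S.card ≤ Module.finrank ℝ J := by
  classical
  have hli : LinearIndependent ℝ (fun q : S => (q : J)) := by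
    rw [Fintype.linearIndependent_iff]
    intro g hg q
    have h1 := congrArg (fun z => (q : J) * z) hg
    simp only [Finset.mul_sum, mul_zero, mul_smul_comm] at h1
    rw [Finset.sum_eq_single q, h.idem q q.2] at h1
    · exact (smul_eq_zero.1 h1).resolve_right (h.ne_zero q q.2)
    · intro b _ hb
      rw [h.orth q q.2 b b.2 fun hqb => hb (Subtype.ext hqb.symm), smul_zero]
    · simp
  simpa using hli.fintype_card_le_finrank

/-- A non-primitive `p` splits as `a + b`. The parts stay orthogonal to every other `q` because `B q
p = 0` is the sum of the nonnegative numbers `B q a` and `B q b`, and an idempotent pair with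
vanishing form has product zero. -/
theorem IsIdempotentSystem.exists_refinement {x : J} {S : Finset J} (h : IsIdempotentSystem x S)
    {p : J} (hpS : p ∈ S) (hp : ¬ IsPrimitiveIdempotent p) :
    ∃ S', IsIdempotentSystem x S' ∧ S.card < S'.card := by
  classical
  obtain ⟨B, hB⟩ := exists_isAssocInner J
  have hpp := h.idem p hpS
  obtain ⟨a, b, ha, hb, ha0, hb0, hab⟩ :
      ∃ a b : J, IsIdempotentElem a ∧ IsIdempotentElem b ∧ a ≠ 0 ∧ b ≠ 0 ∧ p = a + b := by
    by_contra hc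
    exact hp ⟨hpp, h.ne_zero p hpS, hc⟩
  have ha : a * a = a := ha
  have hb : b * b = b := hb
  have hab0 : a * b = 0 := mul_eq_zero_of_add ha hb (hab ▸ hpp)
  have hne : a ≠ b := fun hh => ha0 (by rw [← ha]; nth_rewrite 2 [hh]; exact hab0)
  have horth : ∀ q ∈ S.erase p, q * a = 0 ∧ q * b = 0 := by
    intro q hq
    obtain ⟨hqp, hqS⟩ := Finset.mem_erase.1 hq
    have h1 := hB.idempotent_nonneg (h.idem q hqS) ha
    have h2 := hB.idempotent_nonneg (h.idem q hqS) hb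
    have h3 := hB.eq_zero_of_mul_eq_zero (h.orth q hqS p hpS hqp)
    rw [hab, map_add] at h3
    exact ⟨h1.2 (by linarith [h1.1, h2.1]), h2.2 (by linarith [h1.1, h2.1])⟩
  have haS : a ∉ S.erase p := fun hh => ha0 (by rw [← ha]; exact (horth a hh).1)
  have hbS : b ∉ S.erase p := fun hh => hb0 (by rw [← hb]; exact (horth b hh).2)
  have haS' : a ∉ insert b (S.erase p) := by
    simp only [Finset.mem_insert, not_or]; exact ⟨hne, haS⟩
  refine ⟨insert a (insert b (S.erase p)), ⟨?_, ?_, ?_, ?_, ?_⟩, ?_⟩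
  · simp only [Finset.forall_mem_insert]
    exact ⟨ha, hb, fun q hq => h.idem q (Finset.mem_of_mem_erase hq)⟩
  · simp only [Finset.forall_mem_insert]
    exact ⟨ha0, hb0, fun q hq => h.ne_zero q (Finset.mem_of_mem_erase hq)⟩
  · simp only [Finset.forall_mem_insert]
    refine ⟨⟨fun hh => absurd rfl hh, fun _ => hab0, fun q hq _ => ?_⟩,
      ⟨fun _ => by rw [mul_comm, hab0], fun hh => absurd rfl hh, fun q hq _ => ?_⟩,
      fun q hq => ⟨fun _ => (horth q hq).1, fun _ => (horth q hq).2, fun q' hq' =>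
        h.orth q (Finset.mem_of_mem_erase hq) q' (Finset.mem_of_mem_erase hq')⟩⟩
    · rw [mul_comm]; exact (horth q hq).1
    · rw [mul_comm]; exact (horth q hq).2
  · rw [Finset.sum_insert haS', Finset.sum_insert hbS, ← add_assoc, ← hab]
    exact (Finset.add_sum_erase S id hpS).trans h.sum_eq_one
  · refine Submodule.span_le.2 (fun q hq => ?_) h.mem_span
    by_cases hqp : q = p
    · rw [hqp, hab]
      exact Submodule.add_mem _ (Submodule.subset_span (by simp)) (Submodule.subset_span (by simp))
    · exact Submodule.subset_span (by simp [hqp, Finset.mem_coe.1 hq])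
  · rw [Finset.card_insert_of_notMem haS', Finset.card_insert_of_notMem hbS,
      Finset.card_erase_of_mem hpS]
    have := Finset.card_pos.2 ⟨p, hpS⟩
    omega

/-- The spectral theorem: every element has a spectral decomposition over a Jordan frame. -/
theorem exists_isSpectralDecomposition (x : J) :
    ∃ (r : ℕ) (q : Fin r → J) (l : Fin r → ℝ), IsSpectralDecomposition x q l := by
  classical
  let A : Set ℕ := {n | ∃ S, IsIdempotentSystem x S ∧ S.card = n}
  have hne : A.Nonempty := let ⟨S, hS⟩ := exists_isIdempotentSystem x; ⟨_, S, hS, rfl⟩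
  have hbdd : BddAbove A := ⟨Module.finrank ℝ J, by rintro n ⟨S, hS, rfl⟩; exact hS.card_le⟩
  -- A system of maximal cardinality admits no refinement, so its members are primitive.
  obtain ⟨S, hS, hcard⟩ := Nat.sSup_mem hne hbdd
  have hprim : ∀ p ∈ S, IsPrimitiveIdempotent p := by
    intro p hp
    by_contra hnp
    obtain ⟨S', hS', hlt⟩ := hS.exists_refinement hp hnp
    have : S'.card ≤ sSup A := le_csSup hbdd ⟨S', hS', rfl⟩
    omega
  obtain ⟨l, -, hl⟩ := Submodule.mem_span_finset.1 hS.mem_span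
  let e := S.equivFin.symm
  refine ⟨S.card, fun k => e k, fun k => l (e k), ⟨fun k => hprim _ (e k).2, fun k m hkm =>
    hS.orth _ (e k).2 _ (e m).2 fun hh => hkm (e.injective (Subtype.ext hh)), ?_⟩, ?_⟩
  · rw [Equiv.sum_comp e (fun q : S => (q : J)), Finset.sum_coe_sort S (fun q => q)]
    exact hS.sum_eq_one
  · rw [Equiv.sum_comp e (fun q : S => l q • (q : J)), Finset.sum_coe_sort S (fun q => l q • q), hl]

/-- Multiplication by an element of the Peirce space `V(p, 1)` commutes with multiplication
by `p`. -/
theorem commute_lmul_of_mul_eq {p y : J} (hp : p * p = p) (hy : p * y = y) :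
    Commute (lmul p) (lmul y) := by
  ext z
  have h : (2 : ℕ) • ((p * (p * y * z) - p * y * (p * z)) + (p * (y * p * z) - y * p * (p * z))
      + (y * (p * p * z) - p * p * (y * z))) = 0 :=
    DFunLike.congr_fun (two_nsmul_lie_lmul_lmul_add_add_eq_zero p p y) z
  rw [mul_comm y p, hp, hy] at h
  simp only [Module.End.mul_apply, LinearMap.mulLeft_apply]
  rw [← ofNat_smul_eq_nsmul ℝ] at h
  have h3 := (smul_eq_zero.1 h).resolve_left two_ne_zero
  rw [← sub_eq_zero, ← h3]
  abel

/-- The Peirce space `V(p, 1)` of a primitive idempotent is a line. -/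
theorem IsPrimitiveIdempotent.eq_smul_of_mul_eq {p y : J} (hp : IsPrimitiveIdempotent p)
    (hy : p * y = y) : ∃ c : ℝ, y = c • p := by
  have hpp : p * p = p := hp.1
  by_cases hy0 : y = 0
  · exact ⟨0, by simp [hy0]⟩
  obtain ⟨s, v, hsum, heig, horth, hidem, hpoly⟩ := exists_spectral_idempotents y
  have hysum : y = ∑ a ∈ s, a • v a := by
    rw [← Finset.sum_congr rfl heig, ← Finset.mul_sum, hsum, mul_one]
  obtain ⟨a, ha, hav⟩ : ∃ a ∈ s, a • v a ≠ 0 := by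
    by_contra! hc
    exact hy0 (hysum.trans (Finset.sum_eq_zero hc))
  have ha0 : a ≠ 0 := fun h => hav (by simp [h])
  have hv0 : v a ≠ 0 := fun h => hav (by simp [h])
  have hcomm : ∀ f : Polynomial ℝ, Commute (lmul p) (Polynomial.aeval (lmul y) f) := fun f => by
    have hmem : Polynomial.aeval (lmul y) f ∈ Algebra.adjoin ℝ {lmul y} :=
      Polynomial.aeval_mem_adjoin_singleton ℝ (lmul y)
    exact Algebra.commute_of_mem_adjoin_singleton_of_commute hmem (commute_lmul_of_mul_eq hpp hy)
  -- With `v a = f(y)`, the vector `a • v a` is `f` of `lmul y` applied to `y`. As `lmul p` commutes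
  -- with that operator and fixes `y`, it fixes `a • v a`, and `a ≠ 0`.
  have hpv : p * v a = v a := by
    obtain ⟨f, hf⟩ := hpoly a ha
    have h1 : a • v a = Polynomial.aeval (lmul y) f y := by
      have := congrArg (fun T : Module.End ℝ J => T 1)
        (Algebra.commute_of_mem_adjoin_self
          (Polynomial.aeval_mem_adjoin_singleton ℝ (p := f) (lmul y))).eq
      rw [← heig a ha, hf]
      simpa using this
    have h2 := congrArg (fun T : Module.End ℝ J => T y) (hcomm f).eq
    simp only [Module.End.mul_apply, LinearMap.mulLeft_apply, hy, ← h1, mul_smul_comm] at h2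
    exact smul_right_injective _ ha0 h2
  -- Otherwise `p = v a + (p - v a)` would be a forbidden splitting.
  have hvp : v a = p := by
    by_contra hne
    refine hp.2.2 ⟨v a, p - v a, hidem a ha, ?_, hv0, sub_ne_zero.2 (Ne.symm hne), by abel⟩
    change (p - v a) * (p - v a) = p - v a
    rw [sub_mul, mul_sub, mul_sub, mul_comm (v a) p, hpp, hpv, hidem a ha]
    abel
  refine ⟨a, ?_⟩
  rw [← hvp, ← heig a ha, hvp, mul_comm, hy]

/-- The polynomial 2t² - t is 0, 0, 1 at the Peirce eigenvalues 0, 1/2, 1, so it projects `z` onto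
`V(p, 1)`, a line spanned by `p`. Pairing with `p` finds the coefficient. -/
theorem IsAssocInner.peirce_one (hB : IsAssocInner B) {p : J} (hp : IsPrimitiveIdempotent p)
    (z : J) : B p p • ((2 : ℝ) • (p * (p * z)) - p * z) = B p z • p := by
  have hpp : p * p = p := hp.1
  have h1 : p * ((2 : ℝ) • (p * (p * z)) - p * z) = (2 : ℝ) • (p * (p * z)) - p * z := by
    rw [mul_sub, mul_smul_comm, peirce_equation hpp z]
    module
  obtain ⟨c, hc⟩ := hp.eq_smul_of_mul_eq h1
  have h2 := congrArg (fun w => B p w) hc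
  have h3 : ∀ w, B p (p * w) = B p w := fun w => by rw [← hB.assoc_right, hpp]
  simp only [map_sub, map_smul, h3, smul_eq_mul] at h2
  rw [hc, smul_smul]
  congr 1
  linarith

/-- Non-orthogonal primitive idempotents have the same norm. -/
theorem IsAssocInner.primitive_norm_eq (hB : IsAssocInner B) {p q : J}
    (hp : IsPrimitiveIdempotent p) (hq : IsPrimitiveIdempotent q) (h : B p q ≠ 0) :
    B p p = B q q := by
  -- Pairing `peirce_one` with `q` gives an identity whose right side and second factor are
  -- symmetric in `p` and `q`; swapping them and cancelling compares the norms.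
  have key : ∀ p q : J, IsPrimitiveIdempotent p → IsPrimitiveIdempotent q →
      B p p * (2 * B (p * q) (p * q) - B p q) = B p q * B p q := by
    intro p q hp hq
    have hqq : q * q = q := hq.1
    have h1 := congrArg (fun w => B w q) (hB.peirce_one hp q)
    simp only [map_sub, map_smul, LinearMap.sub_apply, LinearMap.smul_apply, smul_eq_mul] at h1
    rw [hB.assoc p (p * q) q, hB.assoc_right p q q, hqq] at h1
    exact h1
  have h1 := key p q hp hq
  have h2 := key q p hq hp
  rw [mul_comm q p, hB.symm q p] at h2
  have h3 : 2 * B (p * q) (p * q) - B p q ≠ 0 := fun h0 => by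
    rw [h0, mul_zero] at h1
    exact h (mul_self_eq_zero.1 h1.symm)
  exact mul_right_cancel₀ h3 (h1.trans h2.symm)

omit [IsEuclideanJordanAlgebra J] in
theorem IsAssocInner.primitive_self_pos (hB : IsAssocInner B) {p : J}
    (hp : IsPrimitiveIdempotent p) : 0 < B p p :=
  hB.pos p hp.2.1

/-- In each nonzero term `B (q k) (q k)` equals `B p p`. With this common denominator the numerators
add up to `B 1 p = B p p`. -/
theorem IsAssocInner.frame_sum_eq_one (hB : IsAssocInner B) {r : ℕ} {q : Fin r → J}
    (hq : IsJordanFrame q) {p : J} (hp : IsPrimitiveIdempotent p) :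
    ∑ k, B (q k) p / B (q k) (q k) = 1 := by
  have h1 : ∀ k, B (q k) p / B (q k) (q k) = B (q k) p / B p p := fun k => by
    by_cases h : B (q k) p = 0
    · simp [h]
    · rw [hB.primitive_norm_eq (hq.primitive k) hp h]
  have hpp : p * p = p := hp.1
  rw [Finset.sum_congr rfl fun k _ => h1 k, ← Finset.sum_div, ← LinearMap.sum_apply, ← map_sum,
    hq.sum_eq_one, div_eq_one_iff_eq (hB.primitive_self_pos hp).ne']
  nth_rewrite 1 [← hpp]
  rw [← hB.assoc, mul_one]

variable (J) in
/-- There is a linear functional with value `1` at every primitive idempotent. -/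
theorem exists_linear_trace :
    ∃ T : J →ₗ[ℝ] ℝ, ∀ p, IsPrimitiveIdempotent p → T p = 1 := by
  obtain ⟨B, hB⟩ := exists_isAssocInner J
  obtain ⟨r, q, l, hq, -⟩ := exists_isSpectralDecomposition (0 : J)
  refine ⟨∑ k, (B (q k) (q k))⁻¹ • B (q k), fun p hp => ?_⟩
  rw [← hB.frame_sum_eq_one hq hp]
  simp [LinearMap.sum_apply, div_eq_inv_mul]

omit [IsEuclideanJordanAlgebra J] in
theorem IsAssocInner.coeff_eq (hB : IsAssocInner B) {x : J} {r : ℕ} {q : Fin r → J}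
    {l : Fin r → ℝ} (h : IsSpectralDecomposition x q l) (k : Fin r) :
    l k = B (q k) x / B (q k) (q k) := by
  rw [eq_div_iff (hB.primitive_self_pos (h.1.primitive k)).ne', h.2, map_sum,
    Finset.sum_eq_single k]
  · simp
  · intro m _ hm
    rw [map_smul, hB.eq_zero_of_mul_eq_zero (h.1.orthogonal k m hm.symm), smul_zero]
  · simp

end Peirce

/-! ### Trace, trace norms and gradients -/

section Trace

variable {J : Type*} [NonAssocCommRing J] [Module ℝ J] [IsEuclideanJordanAlgebra J]

theorem exists_eigenvalues_eq (x : J) : ∃ (r : ℕ) (q : Fin r → J) (l : Fin r → ℝ),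
    IsSpectralDecomposition x q l ∧ eigenvalues x = Finset.univ.val.map l := by
  have h : ∃ s, IsEigenvalueMultiset x s := by
    obtain ⟨r, q, l, h⟩ := exists_isSpectralDecomposition x
    exact ⟨_, r, q, l, h, rfl⟩
  have h2 := h.choose_spec
  have h3 : eigenvalues x = h.choose := dif_pos h
  rw [← h3] at h2
  exact h2

/-- A spectral decomposition computing the trace and both norms. -/
theorem exists_spectral_data (x : J) : ∃ (r : ℕ) (q : Fin r → J) (l : Fin r → ℝ),
    IsSpectralDecomposition x q l ∧ trace x = ∑ k, l k ∧ trNormOne x = ∑ k, |l k| ∧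
      ∀ a, a ∈ eigenvalues x ↔ ∃ k, l k = a := by
  obtain ⟨r, q, l, h, he⟩ := exists_eigenvalues_eq x
  refine ⟨r, q, l, h, ?_, ?_, ?_⟩
  · rw [trace, he]; rfl
  · rw [trNormOne, he, Multiset.map_map]; rfl
  · intro a; rw [he]; simp

theorem trace_eq_of_linear {T : J →ₗ[ℝ] ℝ} (hT : ∀ p, IsPrimitiveIdempotent p → T p = 1) (x : J) :
    trace x = T x := by
  obtain ⟨r, q, l, h, ht, -⟩ := exists_spectral_data x
  rw [ht, h.2, map_sum]
  exact Finset.sum_congr rfl fun k _ => by rw [map_smul, hT _ (h.1.primitive k), smul_eq_mul, mul_one]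

variable (J) in
/-- The trace is linear, with value `1` at primitive idempotents. -/
theorem exists_trace_linear : ∃ T : J →ₗ[ℝ] ℝ, (∀ x, trace x = T x) ∧
    ∀ p, IsPrimitiveIdempotent p → T p = 1 :=
  let ⟨T, hT⟩ := exists_linear_trace J
  ⟨T, trace_eq_of_linear hT, hT⟩

/-- The trace-1 norm is bounded by the sum of the absolute values of the coefficients in any
combination of primitive idempotents. -/
theorem trNormOne_le_sum {κ : Type*} (s : Finset κ) (p : κ → J) (c : κ → ℝ)
    (hp : ∀ k ∈ s, IsPrimitiveIdempotent (p k)) :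
    trNormOne (∑ k ∈ s, c k • p k) ≤ ∑ k ∈ s, |c k| := by
  obtain ⟨B, hB⟩ := exists_isAssocInner J
  obtain ⟨r, q, l, h, -, hn, -⟩ := exists_spectral_data (∑ k ∈ s, c k • p k)
  -- These weights express the eigenvalues through the `c k`; for fixed `k` they are nonnegative
  -- with sum one over `m`.
  have hnn : ∀ m, ∀ k ∈ s, 0 ≤ B (q m) (p k) / B (q m) (q m) := fun m k hk =>
    div_nonneg (hB.idempotent_nonneg (h.1.primitive m).1 (hp k hk).1).1
      (hB.primitive_self_pos (h.1.primitive m)).le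
  rw [hn]
  calc ∑ m, |l m| = ∑ m, |∑ k ∈ s, c k * (B (q m) (p k) / B (q m) (q m))| := by
        refine Finset.sum_congr rfl fun m _ => ?_
        rw [hB.coeff_eq h m, map_sum, Finset.sum_div]
        simp only [map_smul, smul_eq_mul, mul_div_assoc]
    _ ≤ ∑ m, ∑ k ∈ s, |c k| * (B (q m) (p k) / B (q m) (q m)) := by
        refine Finset.sum_le_sum fun m _ => (Finset.abs_sum_le_sum_abs _ _).trans_eq ?_
        exact Finset.sum_congr rfl fun k hk => by rw [abs_mul, abs_of_nonneg (hnn m k hk)]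
    _ = ∑ k ∈ s, |c k| := by
        rw [Finset.sum_comm]
        refine Finset.sum_congr rfl fun k hk => ?_
        rw [← Finset.mul_sum, hB.frame_sum_eq_one h.1 (hp k hk), mul_one]

theorem trNormOne_nonneg (x : J) : 0 ≤ trNormOne x := by
  obtain ⟨r, q, l, -, -, hn, -⟩ := exists_spectral_data x
  rw [hn]
  exact Finset.sum_nonneg fun k _ => abs_nonneg _

theorem trNormOne_smul_le (c : ℝ) (x : J) : trNormOne (c • x) ≤ |c| * trNormOne x := by
  obtain ⟨r, q, l, h, -, hn, -⟩ := exists_spectral_data x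
  have := trNormOne_le_sum Finset.univ q (fun k => c * l k) fun k _ => h.1.primitive k
  rw [hn, Finset.mul_sum]
  simpa only [abs_mul, mul_smul, ← Finset.smul_sum, ← h.2] using this

theorem IsPrimitiveIdempotent.trNormOne_le_one {p : J} (hp : IsPrimitiveIdempotent p) :
    trNormOne p ≤ 1 := by
  simpa using trNormOne_le_sum {()} (fun _ => p) (fun _ => 1) fun _ _ => hp

theorem IsPrimitiveIdempotent.mem_genSimplex {p : J} (hp : IsPrimitiveIdempotent p) :
    p ∈ genSimplex J := by
  obtain ⟨T, hT, hT1⟩ := exists_trace_linear J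
  exact ⟨⟨p, hp.1.symm⟩, by rw [hT, hT1 p hp]⟩

theorem IsJordanFrame.sum_mul_sum {r : ℕ} {q : Fin r → J} (hq : IsJordanFrame q)
    (l : Fin r → ℝ) :
    (∑ k, l k • q k) * (∑ k, l k • q k) = ∑ k, (l k * l k) • q k := by
  rw [Finset.sum_mul]
  refine Finset.sum_congr rfl fun k _ => ?_
  rw [Finset.mul_sum, Finset.sum_eq_single k]
  · rw [smul_mul_assoc, mul_smul_comm, smul_smul, (hq.primitive k).1]
  · intro m _ hm
    rw [smul_mul_assoc, mul_smul_comm, hq.orthogonal k m hm.symm, smul_zero, smul_zero]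
  · simp

/-- A square has nonnegative coefficients `l k * l k` over the frame of its root, and these sum to
the trace. -/
theorem trNormOne_le_one_of_mem_genSimplex {x : J} (hx : x ∈ genSimplex J) : trNormOne x ≤ 1 := by
  obtain ⟨T, hT, hT1⟩ := exists_trace_linear J
  obtain ⟨⟨y, rfl⟩, htr⟩ := hx
  obtain ⟨r, q, l, h⟩ := exists_isSpectralDecomposition y
  have hy : y * y = ∑ k, (l k * l k) • q k := by rw [h.2, h.1.sum_mul_sum]
  rw [hT, hy, map_sum] at htr
  rw [hy]
  refine (trNormOne_le_sum _ _ _ fun k _ => h.1.primitive k).trans_eq ?_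
  rw [← htr]
  refine Finset.sum_congr rfl fun k _ => ?_
  rw [map_smul, hT1 _ (h.1.primitive k), abs_of_nonneg (mul_self_nonneg _), smul_eq_mul, mul_one]

/-- The canonical inner product represents every linear functional. -/
theorem exists_traceInner_eq (φ : J →ₗ[ℝ] ℝ) : ∃ g : J, ∀ h, traceInner g h = φ h := by
  obtain ⟨T, hT, hT1⟩ := exists_trace_linear J
  let F : J →ₗ[ℝ] Module.Dual ℝ J := (LinearMap.mul ℝ J).compr₂ T
  have hF : ∀ x y, F x y = T (x * y) := fun x y => rfl
  -- The trace form is definite: `T (x * x)` is the sum of the squared coefficients of `x`.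
  have hinj : Function.Injective F := by
    rw [injective_iff_map_eq_zero]
    intro x hx
    obtain ⟨r, q, l, h⟩ := exists_isSpectralDecomposition x
    have h1 : T (x * x) = 0 := by rw [← hF, hx]; rfl
    rw [h.2, h.1.sum_mul_sum, map_sum] at h1
    simp only [map_smul, hT1 _ (h.1.primitive _), smul_eq_mul, mul_one] at h1
    have h2 := (Finset.sum_eq_zero_iff_of_nonneg fun k _ => mul_self_nonneg (l k)).1 h1
    rw [h.2]
    exact Finset.sum_eq_zero fun k hk => by rw [mul_self_eq_zero.1 (h2 k hk), zero_smul]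
  have hsurj : Function.Surjective F :=
    (LinearMap.injective_iff_surjective_of_finrank_eq_finrank
      (Subspace.dual_finrank_eq (K := ℝ) (V := J)).symm).1 hinj
  obtain ⟨g, hg⟩ := hsurj φ
  exact ⟨g, fun h => by rw [traceInner, hT, ← hF, hg]⟩

/-- The gradient of an affine functional exists, and it represents the linear part. -/
theorem gradientAt_spec {f : J → ℝ} {φ : J →ₗ[ℝ] ℝ} {x : J} (hf : ∀ h, f (x + h) = f x + φ h) :
    IsGradientAt f (gradientAt f x) x ∧ ∀ h, traceInner (gradientAt f x) h = φ h := by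
  obtain ⟨T, hT, -⟩ := exists_trace_linear J
  have hex : ∃ g, IsGradientAt f g x := by
    obtain ⟨g, hg⟩ := exists_traceInner_eq φ
    refine ⟨g, fun ε hε => ⟨1, one_pos, fun h _ => ?_⟩⟩
    rw [hf, hg, add_sub_cancel_left, sub_self, abs_zero]
    exact mul_nonneg hε.le (trNormOne_nonneg h)
  have hgrad : IsGradientAt f (gradientAt f x) x := by
    have h3 : gradientAt f x = hex.choose := dif_pos hex
    rw [h3]
    exact hex.choose_spec
  refine ⟨hgrad, fun h => ?_⟩
  -- The gradient is a choice, so an arbitrary one must be shown to represent `φ`. Scaling `h` into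
  -- the δ-ball and dividing the scale out makes the estimate hold for every `h` and every `ε`.
  generalize gradientAt f x = g at hgrad
  have hsmall : ∀ ε > 0, |φ h - T (g * h)| ≤ ε * trNormOne h := by
    intro ε hε
    obtain ⟨δ, hδ, H⟩ := hgrad ε hε
    have hn := trNormOne_nonneg h
    obtain ⟨t, ht, hlt⟩ : ∃ t > 0, t * trNormOne h < δ :=
      ⟨δ / (trNormOne h + 1), by positivity, by
        rw [div_mul_eq_mul_div, div_lt_iff₀ (by positivity)]; nlinarith⟩
    have hle := trNormOne_smul_le t h
    rw [abs_of_pos ht] at hle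
    have h1 := H (t • h) (hle.trans_lt hlt)
    rw [hf, add_sub_cancel_left, traceInner, hT, mul_smul_comm, map_smul, map_smul,
      smul_eq_mul, smul_eq_mul, ← mul_sub, abs_mul, abs_of_pos ht] at h1
    have h2 := h1.trans (mul_le_mul_of_nonneg_left hle hε.le)
    rw [mul_left_comm] at h2
    exact le_of_mul_le_mul_left h2 ht
  have h0 : |φ h - T (g * h)| ≤ 0 := by
    refine le_of_forall_pos_le_add fun ε hε => ?_
    have hn := trNormOne_nonneg h
    refine (hsmall (ε / (trNormOne h + 1)) (by positivity)).trans ?_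
    rw [zero_add, div_mul_eq_mul_div, div_le_iff₀ (by positivity)]
    nlinarith
  rw [traceInner, hT]
  linarith [abs_nonpos_iff.1 h0]

omit [IsEuclideanJordanAlgebra J] in
theorem trNormOneDual_le {v : J} {C : ℝ} (hC : ∀ w, traceInner v w ≤ C * trNormOne w)
    (hC0 : 0 ≤ C) : trNormOneDual v ≤ C := by
  refine Real.sSup_le ?_ hC0
  rintro a ⟨w, hw, rfl⟩
  rw [traceInner, mul_comm, ← traceInner]
  exact (hC w).trans (mul_le_of_le_one_right hC0 hw)

/-- Each eigenvalue of `v` is its pairing with a frame element, whose trace-1 norm is at most one.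
The condition `0 ≤ C` covers the zero algebra, where the supremum is over the empty set. -/
theorem trNormInf_le {v : J} {C : ℝ} (hC : ∀ w, |traceInner v w| ≤ C * trNormOne w)
    (hC0 : 0 ≤ C) : trNormInf v ≤ C := by
  obtain ⟨T, hT, hT1⟩ := exists_trace_linear J
  obtain ⟨r, q, l, h, -, -, he⟩ := exists_spectral_data v
  refine Real.sSup_le ?_ hC0
  rintro a ⟨b, hb, rfl⟩
  obtain ⟨k, rfl⟩ := (he b).1 hb
  have h1 : v * q k = l k • q k := by
    rw [h.2, Finset.sum_mul, Finset.sum_eq_single k]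
    · rw [smul_mul_assoc, (h.1.primitive k).1]
    · intro m _ hm
      rw [smul_mul_assoc, h.1.orthogonal m k hm, smul_zero]
    · simp
  have h2 := hC (q k)
  rw [traceInner, h1, hT, map_smul, hT1 _ (h.1.primitive k), smul_eq_mul, mul_one] at h2
  exact h2.trans (mul_le_of_le_one_right hC0 (h.1.primitive k).trNormOne_le_one)

end Trace

/-! ### Product algebras and multilinear estimates -/

section Product

variable {ι : Type*} [Fintype ι] [DecidableEq ι] {J : ι → Type*} [∀ i, NonAssocCommRing (J i)]
  [∀ i, Module ℝ (J i)] [∀ i, IsEuclideanJordanAlgebra (J i)]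

omit [DecidableEq ι] in
variable (J) in
theorem isEuclideanJordanAlgebra_pi : IsEuclideanJordanAlgebra (∀ i, J i) where
  smul_mul c x y := funext fun i => IsEuclideanJordanAlgebra.smul_mul c (x i) (y i)
  jordan := ⟨fun x y => funext fun i => IsCommJordan.lmul_comm_rmul_rmul (x i) (y i)⟩
  finiteDimensional := inferInstanceAs (FiniteDimensional ℝ (∀ i, J i))
  exists_inner := by
    choose B hB using fun i => exists_isAssocInner (J i)
    have key : ∀ x y : ∀ i, J i,
        (∑ i, (B i).compl₁₂ (LinearMap.proj i) (LinearMap.proj i) : LinearMap.BilinForm ℝ (∀ i, J i)) x y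
          = ∑ i, B i (x i) (y i) := fun x y => by
      simp [LinearMap.sum_apply]
    refine ⟨∑ i, (B i).compl₁₂ (LinearMap.proj i) (LinearMap.proj i), ?_, ?_, ?_⟩
    · intro x y
      rw [key, key]
      exact Finset.sum_congr rfl fun i _ => (hB i).symm _ _
    · intro x hx
      rw [key]
      obtain ⟨i, hi⟩ := Function.ne_iff.1 hx
      refine Finset.sum_pos' (fun j _ => ?_) ⟨i, Finset.mem_univ i, (hB i).pos _ hi⟩
      by_cases h : x j = 0
      · simp [h]
      · exact ((hB j).pos _ h).le
    · intro x y z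
      rw [key, key]
      exact Finset.sum_congr rfl fun i _ => (hB i).assoc _ _ _

omit [Fintype ι] [∀ i, Module ℝ (J i)] [∀ i, IsEuclideanJordanAlgebra (J i)] in
/-- The components of a primitive idempotent of a product vanish, but for one which is
primitive. -/
theorem IsPrimitiveIdempotent.pi {p : ∀ i, J i} (hp : IsPrimitiveIdempotent p) :
    ∃ i, IsPrimitiveIdempotent (p i) ∧ ∀ j, j ≠ i → p j = 0 := by
  obtain ⟨hidem, hne, hsplit⟩ := hp
  have hidem' : ∀ j, p j * p j = p j := fun j => congrFun hidem j
  obtain ⟨i, hi⟩ := Function.ne_iff.1 hne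
  have hz : ∀ j, j ≠ i → p j = 0 := by
    intro j hj
    by_contra h0
    -- Two nonzero components would split `p` into its `i`-th component and the rest.
    refine hsplit ⟨Function.update p i 0, Function.update (0 : ∀ i, J i) i (p i), ?_, ?_, ?_, ?_, ?_⟩
    · funext k
      by_cases hk : k = i
      · subst hk; change Function.update p k 0 k * Function.update p k 0 k = _; simp
      · change Function.update p i 0 k * Function.update p i 0 k = _; simp [hk, hidem']
    · funext k
      by_cases hk : k = i
      · subst hk
        change Function.update (0 : ∀ i, J i) k (p k) k * Function.update (0 : ∀ i, J i) k (p k) k = _; simp [hidem']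
      · change Function.update (0 : ∀ i, J i) i (p i) k * Function.update (0 : ∀ i, J i) i (p i) k = _; simp [hk]
    · exact Function.ne_iff.2 ⟨j, by simpa [hj] using h0⟩
    · exact Function.ne_iff.2 ⟨i, by simpa using hi⟩
    · funext k
      change p k = Function.update p i 0 k + Function.update (0 : ∀ i, J i) i (p i) k
      by_cases hk : k = i
      · subst hk; simp
      · simp [hk]
  refine ⟨i, ⟨hidem' i, hi, ?_⟩, hz⟩
  rintro ⟨a, b, ha, hb, ha0, hb0, hab⟩
  have hup : ∀ c : J i, IsIdempotentElem c → IsIdempotentElem (Function.update (0 : ∀ i, J i) i c) := by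
    intro c hc
    funext k
    by_cases hk : k = i
    · subst hk
      change Function.update (0 : ∀ i, J i) k c k * Function.update (0 : ∀ i, J i) k c k = _; simpa using hc.eq
    · change Function.update (0 : ∀ i, J i) i c k * Function.update (0 : ∀ i, J i) i c k = _; simp [hk]
  refine hsplit ⟨Function.update (0 : ∀ i, J i) i a, Function.update (0 : ∀ i, J i) i b, hup a ha, hup b hb,
    Function.ne_iff.2 ⟨i, by simpa using ha0⟩, Function.ne_iff.2 ⟨i, by simpa using hb0⟩, ?_⟩
  funext k
  change p k = Function.update (0 : ∀ i, J i) i a k + Function.update (0 : ∀ i, J i) i b k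
  by_cases hk : k = i
  · subst hk; simpa using hab
  · simp [hk, hz k hk]

/-- The trace-1 norm of a product dominates the sum of the trace-1 norms of the components. -/
theorem sum_trNormOne_le (x : ∀ i, J i) : ∑ i, trNormOne (x i) ≤ trNormOne x := by
  have := isEuclideanJordanAlgebra_pi J
  obtain ⟨r, q, l, h, -, hn, -⟩ := exists_spectral_data x
  -- Each frame element lives in a single factor `e k`, so sorting the decomposition of `x` by `e`
  -- decomposes every `x i` into primitive idempotents.
  choose e he hz using fun k => (h.1.primitive k).pi
  have hx : ∀ i, x i = ∑ k with e k = i, l k • q k i := by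
    intro i
    have h1 : x i = ∑ k, l k • q k i := by
      conv_lhs => rw [h.2]
      exact (map_sum (LinearMap.proj (R := ℝ) (φ := J) i) (fun k => l k • q k) Finset.univ)
    rw [h1, Finset.sum_filter_of_ne]
    intro k _ hk
    by_contra hne
    exact hk (by rw [hz k i (Ne.symm hne), smul_zero])
  have hle : ∀ i, trNormOne (x i) ≤ ∑ k with e k = i, |l k| := by
    intro i
    rw [hx i]
    refine trNormOne_le_sum _ (fun k => q k i) l fun k hk => ?_
    have hk := (Finset.mem_filter.1 hk).2
    subst hk
    exact he k
  refine (Finset.sum_le_sum fun i _ => hle i).trans_eq ?_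
  rw [hn, Finset.sum_fiberwise]

/-- A multilinear map bounded on the joint strategies is bounded for the trace-1 norms. -/
theorem abs_multilinear_le {u : MultilinearMap ℝ J ℝ} {L : ℝ}
    (hL : ∀ x ∈ jointStrategies J, |u x| ≤ L) (z : ∀ i, J i) :
    |u z| ≤ L * ∏ i, trNormOne (z i) := by
  choose r q l h _ hn _ using fun i => exists_spectral_data (z i)
  have hz : z = fun i => ∑ k, l i k • q i k := funext fun i => (h i).2
  have hu : u z = ∑ k : ∀ i, Fin (r i), (∏ i, l i (k i)) * u fun i => q i (k i) := by
    conv_lhs => rw [hz]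
    rw [MultilinearMap.map_sum]
    exact Finset.sum_congr rfl fun k _ => by rw [MultilinearMap.map_smul_univ, smul_eq_mul]
  rw [hu]
  refine (Finset.abs_sum_le_sum_abs _ _).trans ?_
  calc ∑ k : ∀ i, Fin (r i), |(∏ i, l i (k i)) * u fun i => q i (k i)|
      ≤ ∑ k : ∀ i, Fin (r i), L * ∏ i, |l i (k i)| := by
        refine Finset.sum_le_sum fun k _ => ?_
        rw [abs_mul, Finset.abs_prod, mul_comm]
        exact mul_le_mul_of_nonneg_right
          (hL _ fun i => ((h i).1.primitive (k i)).mem_genSimplex)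
          (Finset.prod_nonneg fun i _ => abs_nonneg _)
    _ = L * ∏ i, trNormOne (z i) := by
        rw [← Finset.mul_sum, Finset.prod_congr rfl fun i _ => hn i, Finset.prod_univ_sum,
          Fintype.piFinset_univ]

/-- Changing the strategies of a set of players changes the value of a bounded multilinear map
by at most the trace-1 norms of the changes. -/
theorem abs_multilinear_piecewise_sub_le {u : MultilinearMap ℝ J ℝ} {L C : ℝ} {i : ι}
    (hL : ∀ x ∈ jointStrategies J, |u x| ≤ L) (hL0 : 0 ≤ L) {x y : ∀ i, J i}
    (hx : ∀ j, j ≠ i → trNormOne (x j) ≤ 1) (hy : ∀ j, j ≠ i → trNormOne (y j) ≤ 1)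
    (hyi : trNormOne (y i) ≤ C) (s : Finset ι) (hs : i ∉ s) :
    |u (s.piecewise x y) - u y| ≤ L * (∑ j ∈ s, trNormOne (x j - y j)) * C := by
  have hC : 0 ≤ C := (trNormOne_nonneg _).trans hyi
  induction s using Finset.induction_on with
  | empty => simp
  | insert j s hj ih =>
    have hji : j ≠ i := fun h => hs (by simp [h])
    have his : i ∉ s := fun h => hs (by simp [h])
    have ih := ih his
    -- The two points differ only in slot `j`, so linearity puts the difference there. Slot `i`
    -- contributes at most `C`, every other slot at most 1.
    have hstep : u ((insert j s).piecewise x y) - u (s.piecewise x y) =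
        u (Function.update (s.piecewise x y) j (x j - y j)) := by
      rw [Finset.piecewise_insert, MultilinearMap.map_update_sub]
      congr 2
      rw [← Finset.piecewise_eq_of_notMem s x y hj, Function.update_eq_self]
    have hbound : |u (Function.update (s.piecewise x y) j (x j - y j))| ≤
        L * (trNormOne (x j - y j) * C) := by
      refine (abs_multilinear_le hL _).trans (mul_le_mul_of_nonneg_left ?_ hL0)
      rw [← Finset.mul_prod_erase Finset.univ _ (Finset.mem_univ j),
        ← Finset.mul_prod_erase (Finset.univ.erase j) _
          (Finset.mem_erase.2 ⟨hji.symm, Finset.mem_univ i⟩)]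
      rw [Function.update_self, Function.update_of_ne hji.symm,
        Finset.piecewise_eq_of_notMem s x y his]
      refine mul_le_mul_of_nonneg_left ?_ (trNormOne_nonneg _)
      refine (mul_le_of_le_one_right (trNormOne_nonneg _) ?_).trans hyi
      refine Finset.prod_le_one (fun k _ => trNormOne_nonneg _) fun k hk => ?_
      simp only [Finset.mem_erase, Finset.mem_univ, and_true] at hk
      rw [Function.update_of_ne hk.2]
      by_cases hks : k ∈ s
      · rw [Finset.piecewise_eq_of_mem s x y hks]; exact hx k hk.1
      · rw [Finset.piecewise_eq_of_notMem s x y hks]; exact hy k hk.1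
    rw [Finset.sum_insert hj]
    calc |u ((insert j s).piecewise x y) - u y|
        = |u (Function.update (s.piecewise x y) j (x j - y j)) + (u (s.piecewise x y) - u y)| := by
          rw [← hstep]; congr 1; ring
      _ ≤ L * (trNormOne (x j - y j) * C) + L * (∑ j ∈ s, trNormOne (x j - y j)) * C :=
          (abs_add_le _ _).trans (add_le_add hbound ih)
      _ = _ := by ring

omit [Fintype ι] in
/-- The payoff vector is the gradient, and it represents the payoff as a function of the own
strategy. -/
theorem payoffVector_spec (u : MultilinearMap ℝ J ℝ) (i : ι) (x : ∀ j, J j) :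
    IsGradientAt (fun y => u (Function.update x i y)) (payoffVector u i x) (x i) ∧
      ∀ w, traceInner (payoffVector u i x) w = u (Function.update x i w) :=
  gradientAt_spec (φ := u.toLinearMap x i) fun h => by simp

/-- The pairing is the difference of `u` at `x` and `y` with slot `i` set to `w` in both. Hence
player `i`'s own change does not enter, and `w` may be any vector. -/
theorem abs_traceInner_payoffVector_sub_le {u : MultilinearMap ℝ J ℝ} {L : ℝ}
    (hL : ∀ x ∈ jointStrategies J, |u x| ≤ L) (hL0 : 0 ≤ L) {x y : ∀ i, J i}
    (hx : x ∈ jointStrategies J) (hy : y ∈ jointStrategies J) (i : ι) (w : J i) :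
    |traceInner (payoffVector u i x - payoffVector u i y) w| ≤
      L * (∑ j ∈ Finset.univ.erase i, trNormOne (x j - y j)) * trNormOne w := by
  obtain ⟨T, hT, -⟩ := exists_trace_linear (J i)
  have h1 : traceInner (payoffVector u i x - payoffVector u i y) w =
      u (Function.update x i w) - u (Function.update y i w) := by
    rw [← (payoffVector_spec u i x).2, ← (payoffVector_spec u i y).2]
    simp only [traceInner, hT, sub_mul, map_sub]
  have h2 : (Finset.univ.erase i).piecewise x (Function.update y i w) = Function.update x i w := by
    funext j
    by_cases hj : j = i
    · subst hj; simp
    · simp [hj, Finset.piecewise]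
  have h3 := abs_multilinear_piecewise_sub_le (i := i) (C := trNormOne w) hL hL0 (x := x)
    (y := Function.update y i w) (fun j _ => trNormOne_le_one_of_mem_genSimplex (hx j))
    (fun j hj => by
      rw [Function.update_of_ne hj]; exact trNormOne_le_one_of_mem_genSimplex (hy j))
    (by rw [Function.update_self]) (Finset.univ.erase i) (by simp)
  rw [h2] at h3
  rw [h1]
  refine h3.trans_eq ?_
  congr 2
  refine Finset.sum_congr rfl fun j hj => ?_
  rw [Function.update_of_ne (Finset.ne_of_mem_erase hj)]

end Product

end EJA

/-! ### The main theorem -/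

theorem mainTheorem8 {ι : Type*} [Fintype ι] [DecidableEq ι]
    {J : ι → Type*} [∀ i, NonAssocCommRing (J i)] [∀ i, Module ℝ (J i)]
    [∀ i, IsEuclideanJordanAlgebra (J i)]
    (u : ι → MultilinearMap ℝ J ℝ) (L : ι → ℝ)
    (hL : ∀ i, ∀ x ∈ EJA.jointStrategies J, |u i x| ≤ L i) :
    -- the payoff vectors are well defined
    (∀ i, ∀ x ∈ EJA.jointStrategies J,
      EJA.IsGradientAt (fun y => u i (Function.update x i y))
        (EJA.payoffVector (u i) i x) (x i)) ∧
    -- the bound along every play, in the dual norm and in the trace-∞ norm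
    (∀ x : ℕ → ∀ i, J i, (∀ t, x t ∈ EJA.jointStrategies J) → ∀ i t,
      EJA.trNormOneDual
          (EJA.payoffVector (u i) i (x (t + 1)) - EJA.payoffVector (u i) i (x t)) ≤
        L i * ∑ j ∈ Finset.univ.erase i, EJA.trNormOne (x (t + 1) j - x t j) ∧
      EJA.trNormInf
          (EJA.payoffVector (u i) i (x (t + 1)) - EJA.payoffVector (u i) i (x t)) ≤
        L i * ∑ j ∈ Finset.univ.erase i, EJA.trNormOne (x (t + 1) j - x t j)) ∧
    -- the payoff vectors are Lipschitz, with the constants `L i`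
    EJA.PayoffsLipschitzWith (fun i => ⇑(u i)) L ∧
    EJA.HasLipschitzPayoffs (fun i => ⇑(u i)) := by
  have hL0 : ∀ {x : ∀ i, J i}, x ∈ EJA.jointStrategies J → ∀ i, 0 ≤ L i := fun hx i =>
    (abs_nonneg _).trans (hL i _ hx)
  have hsum0 : ∀ (x y : ∀ i, J i) (i : ι),
      0 ≤ ∑ j ∈ Finset.univ.erase i, EJA.trNormOne (x j - y j) := fun x y i =>
    Finset.sum_nonneg fun j _ => EJA.trNormOne_nonneg _
  have key : ∀ {x y : ∀ i, J i}, x ∈ EJA.jointStrategies J → y ∈ EJA.jointStrategies J →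
      ∀ (i : ι) (w : J i),
      |EJA.traceInner (EJA.payoffVector (u i) i x - EJA.payoffVector (u i) i y) w| ≤
        L i * (∑ j ∈ Finset.univ.erase i, EJA.trNormOne (x j - y j)) * EJA.trNormOne w :=
    fun hx hy i w => EJA.abs_traceInner_payoffVector_sub_le (hL i) (hL0 hx i) hx hy i w
  have hlip : EJA.PayoffsLipschitzWith (fun i => ⇑(u i)) L := by
    intro i x hx y hy
    refine (EJA.trNormInf_le (key hx hy i) (mul_nonneg (hL0 hx i) (hsum0 x y i))).trans
      (mul_le_mul_of_nonneg_left ?_ (hL0 hx i))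
    exact (Finset.sum_le_sum_of_subset_of_nonneg (Finset.erase_subset _ _)
      fun j _ _ => EJA.trNormOne_nonneg _).trans (EJA.sum_trNormOne_le (x - y))
  refine ⟨fun i x _ => (EJA.payoffVector_spec (u i) i x).1, fun x hx i t => ⟨?_, ?_⟩, hlip, ?_⟩
  · exact EJA.trNormOneDual_le (fun w => (le_abs_self _).trans (key (hx _) (hx _) i w))
      (mul_nonneg (hL0 (hx t) i) (hsum0 _ _ i))
  · exact EJA.trNormInf_le (key (hx _) (hx _) i) (mul_nonneg (hL0 (hx t) i) (hsum0 _ _ i))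
  -- Nonnegativity of `L` follows only from an actual joint strategy; if there is none, the constant
  -- 0 works vacuously.
  · by_cases hne : (EJA.jointStrategies J).Nonempty
    · obtain ⟨x, hx⟩ := hne
      exact ⟨L, hL0 hx, hlip⟩
    · exact ⟨0, fun _ => le_rfl, fun i x hx => absurd ⟨x, hx⟩ hne⟩
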